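/- **Setting.** Let $d\ge 1$, let $\mathcal X\subset\mathbb R^d$ be a finite nonempty action set of size $k$, let $f_0:\mathcal X\to\mathbb R$ be the true reward function, $f^*=\max_{x\in\mathcal X}f_0(x)$, and let $\mathcal W\subseteq\mathbb R^d$ be a parameter set. In rounds $t=0,1,2,\dots$ the learner plays $x_t\in\mathcal X$ and observes $y_t=f_0(x_t)+\eta_t$, where the $\eta_t$ are independent, zero-mean and $\sigma$-sub-Gaussian, $\sigma>0$ (that is, $\mathbb E\,e^{\lambda\eta_t}\le e^{\lambda^2\sigma^2/2}$ for all $\lambda\in\mathbb R$). The cumulative regret is $R_T=\sum_{t=0}^{T-1}(f^*-f_0(x_t))$. **Assumptions.** 1. (Boundedness) $\|x\|_2\le C_b$ for $x\in\mathcal X$, $\|w\|_2\le C_w$ for $w\in\mathcal W$, and $|f_0(x)-f_0(\tilde x)|\le 1$ for $x,\tilde x\in\mathcal X$. 2. (Hyperplane) There are $a\in\mathbb R^d\setminus\{0\}$ and $b\in\mathbb R$ such that every maximizer $x$ of $f_0$ over $\mathcal X$ satisfies $a^\top x=b$. 3. ($\rho$-gap-adjusted misspecification) $0\le\rho<1$,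 $\rho\le \frac{1}{16\sqrt d}$, and there is $w_*\in\mathcal W$ with $|w_*^\top x-f_0(x)|\le\rho\,(f^*-f_0(x))$ for all $x\in\mathcal X$. **Algorithm (modified Phased Elimination with confidence level $\alpha$).** Start with the active set $\mathcal A=\mathcal X$ and $m=\lceil 4d\log\log d\rceil+16$ (for $d=1$ read $\log\log d$ as $0$). In each batch: (i) take a probability distribution $\pi$ on $\mathcal A$ whose support spans $\mathcal A$ and has at most $4d\log\log d+16$ elements, and for which $g(\pi)=\max_{x\in\mathcal A}x^\top V(\pi)^{-1}x\le 2d$, where $V(\pi)=\sum_{x}\pi(x)xx^\top$; (ii) play each $x\in\mathcal A$ exactly $\lceil m\pi(x)\rceil$ times, in any order, giving actions $x_1,\dots,x_u$ with rewards $y_1,\dots,y_u$; (iii) put $\hat w=G^{-1}\sum_{s=1}^u x_sy_s$ with $G=\sum_{s=1}^u x_sx_s^\top$; (iv) replace $\mathcal A$ by $\{x\in\mathcal A:\max_{b\in\mathcal A}\hat w^\top(b-x)\le 16\sqrt{\tfrac dm\log\tfrac1\alpha}\}$, then replace $m$ by $2m$ and start the next batch. Inverses of singular matrices are Moore–Penrose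 inverses. The design $\pi$ and the order of play may be any fixed function of the batch index and the current active set. **Theorem.** There is a universal constant $C>0$ such that, under these assumptions, for every $T\ge1$, the algorithm run with $\alpha=1/(kT)$ satisfies $$R_T\le C\,(1+\rho)\sqrt{dT\log(kT)}$$ with probability at least $1-2\log_2(1+T)\,k\,(kT)^{-1/\sigma^2}$; in particular, for $1$-sub-Gaussian noise, with probability at least $1-\frac{2\log_2(1+T)}{T}$. Moreover, the number of batches used in the first $T$ rounds is always at most $\log_2(1+T)$. -/

import Mathlib

open MeasureTheory ProbabilityTheory
open scoped NNReal

noncomputable section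

namespace PhasedElim

/-- Feature vectors: Euclidean space of dimension `d`. -/
abbrev Vec (d : ℕ) := EuclideanSpace ℝ (Fin d)

/-! ### The misspecified linear bandit -/

/-- The maximum `f^*` of the true reward function `f₀` over the finite nonempty action set. -/
def fstar {d : ℕ} (X : Finset (Vec d)) (hX : X.Nonempty) (f₀ : Vec d → ℝ) : ℝ :=
  X.sup' hX f₀

/-- Boundedness: actions have norm at most `Cb`, parameters have norm at most `Cw`, and the
values of `f₀` on the action set differ by at most `1`. -/
def Bounded {d : ℕ} (X : Finset (Vec d)) (W : Set (Vec d)) (f₀ : Vec d → ℝ) (Cb Cw : ℝ) : Prop :=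
  (∀ x ∈ X, ‖x‖ ≤ Cb) ∧ (∀ w ∈ W, ‖w‖ ≤ Cw) ∧ ∀ x ∈ X, ∀ x' ∈ X, |f₀ x - f₀ x'| ≤ 1

/-- All maximizers of `f₀` over the action set lie on one hyperplane `⟪a, x⟫ = b`, `a ≠ 0`. -/
def MaximizersOnHyperplane {d : ℕ} (X : Finset (Vec d)) (f₀ : Vec d → ℝ) : Prop :=
  ∃ (a : Vec d) (b : ℝ), a ≠ 0 ∧
    ∀ x ∈ X, (∀ x' ∈ X, f₀ x' ≤ f₀ x) → inner ℝ a x = b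

/-- `f` is a `ρ`-gap-adjusted misspecified approximation of `f₀`. The condition is written
multiplied out, so that it forces `f x = f₀ x` at the maximizers of `f₀` (where the quotient
`|f x - f₀ x| / (f^* - f₀ x)` would have denominator zero). -/
def IsGAM {d : ℕ} (X : Finset (Vec d)) (hX : X.Nonempty) (f f₀ : Vec d → ℝ) (ρ : ℝ) : Prop :=
  0 ≤ ρ ∧ ρ < 1 ∧ ∀ x ∈ X, |f x - f₀ x| ≤ ρ * (fstar X hX f₀ - f₀ x)

/-- The linear class `{x ↦ ⟪w, x⟫ | w ∈ W}` satisfies `ρ`-GAM for `f₀`. -/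
def ClassIsGAM {d : ℕ} (X : Finset (Vec d)) (hX : X.Nonempty) (W : Set (Vec d))
    (f₀ : Vec d → ℝ) (ρ : ℝ) : Prop :=
  ∃ w ∈ W, IsGAM X hX (fun x => inner ℝ w x) f₀ ρ

/-! ### Designs and least squares -/

/-- Moore–Penrose inverse of a real symmetric matrix: functional calculus with `t ↦ 1 / t` on
the nonzero eigenvalues and `0 ↦ 0`. It is the ordinary inverse if the matrix is invertible. -/
def pinv {d : ℕ} (G : Matrix (Fin d) (Fin d) ℝ) : Matrix (Fin d) (Fin d) ℝ :=
  cfc (fun t : ℝ => t⁻¹) G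

/-- The rank-one matrix `x xᵀ`. -/
def outer {d : ℕ} (x : Vec d) : Matrix (Fin d) (Fin d) ℝ :=
  Matrix.vecMulVec x.ofLp x.ofLp

/-- The number `4 d log log d + 16`; for `d = 1` the double logarithm is read as `0`
(as `Real.log 0 = 0`). -/
def supportBound (d : ℕ) : ℝ := 4 * (d : ℝ) * Real.log (Real.log d) + 16

/-- The length parameter of batch `ℓ = 0, 1, 2, …`: it is `⌈4 d log log d⌉ + 16` for the first
batch and doubles from each batch to the next. -/
def batchParam (d ℓ : ℕ) : ℕ := 2 ^ ℓ * (⌈4 * (d : ℝ) * Real.log (Real.log d)⌉ + 16).toNat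

/-- The information matrix `V(π) = ∑ π(x) x xᵀ` of a design on `A`. -/
def infoMatrix {d : ℕ} (A : Finset (Vec d)) (π : Vec d → ℝ) : Matrix (Fin d) (Fin d) ℝ :=
  ∑ x ∈ A, π x • outer x

open Classical in
/-- `π` is an approximate G-optimal design on `A`: a probability distribution on `A` with
support of size at most `4 d log log d + 16`, with `g(π) = max_{x ∈ A} ‖x‖²_{V(π)⁻¹} ≤ 2 d`.
Since `A` need not span the whole space, `V(π)⁻¹` is the Moore–Penrose inverse, and the support
of `π` is required to span `A`. -/
structure IsGoodDesign {d : ℕ} (A : Finset (Vec d)) (π : Vec d → ℝ) : Prop where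
  nonneg : ∀ x, 0 ≤ π x
  eq_zero : ∀ x, x ∉ A → π x = 0
  sum_eq_one : ∑ x ∈ A, π x = 1
  card_support : ((A.filter fun x => π x ≠ 0).card : ℝ) ≤ supportBound d
  spanning : ∀ x ∈ A, x ∈ Submodule.span ℝ {z : Vec d | π z ≠ 0}
  g_le : ∀ x ∈ A, x.ofLp ⬝ᵥ (pinv (infoMatrix A π)).mulVec x.ofLp ≤ 2 * d

open Classical in
/-- A batch rule tells which sequence of actions to play in batch `ℓ` when the active set is
`A`. It is valid for `X` if for every possible active set the sequence plays each action `x`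
exactly `⌈m π(x)⌉` times, where `m` is the batch parameter and `π` an approximate G-optimal
design on the active set. The choice of `π` and the order of play are arbitrary. -/
def IsValidRule {d : ℕ} (X : Finset (Vec d)) (rule : ℕ → Finset (Vec d) → List (Vec d)) : Prop :=
  ∀ (ℓ : ℕ) (A : Finset (Vec d)), A ⊆ X → A.Nonempty →
    ∃ π : Vec d → ℝ, IsGoodDesign A π ∧
      ∀ x, (rule ℓ A).count x = ⌈(batchParam d ℓ : ℝ) * π x⌉₊

/-- Least-squares estimate `ŵ = G⁻¹ ∑ yₛ xₛ`, `G = ∑ xₛ xₛᵀ`, from the actions `xs` with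
rewards `y 0, y 1, …` (Moore–Penrose inverse, if `G` is singular). -/
def leastSquares {d : ℕ} (xs : List (Vec d)) (y : ℕ → ℝ) : Vec d :=
  WithLp.toLp 2 ((pinv (∑ s : Fin xs.length, outer (xs.get s))).mulVec
    (∑ s : Fin xs.length, y s • (xs.get s).ofLp))

/-! ### The algorithm -/

/-- The state at the start of a batch: active set and index of the first round of the batch. -/
structure State (d : ℕ) where
  active : Finset (Vec d)
  start : ℕ

open Classical in
/-- Phased elimination with confidence level `α`, run on the action set `X`. The argument `obs`
is the environment: `obs t x` is the reward observed if action `x` is played in round `t`.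
`state … ℓ` is the state at the start of batch `ℓ`. -/
def state {d : ℕ} (X : Finset (Vec d)) (rule : ℕ → Finset (Vec d) → List (Vec d)) (α : ℝ)
    (obs : ℕ → Vec d → ℝ) : ℕ → State d
  | 0 => ⟨X, 0⟩
  | ℓ + 1 =>
    let s := state X rule α obs ℓ
    let xs := rule ℓ s.active
    let w := leastSquares xs fun j => obs (s.start + j) (xs.getD j 0)
    ⟨s.active.filter fun x => ∀ b ∈ s.active,
        inner ℝ w (b - x) ≤ 16 * Real.sqrt ((d : ℝ) / batchParam d ℓ * Real.log (1 / α)),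
      s.start + xs.length⟩

/-- The index of the batch that contains round `t`. -/
def batchAt {d : ℕ} (X : Finset (Vec d)) (rule : ℕ → Finset (Vec d) → List (Vec d)) (α : ℝ)
    (obs : ℕ → Vec d → ℝ) (t : ℕ) : ℕ :=
  Nat.findGreatest (fun ℓ => (state X rule α obs ℓ).start ≤ t) t

/-- The action played in round `t = 0, 1, 2, …`. -/
def action {d : ℕ} (X : Finset (Vec d)) (rule : ℕ → Finset (Vec d) → List (Vec d)) (α : ℝ)
    (obs : ℕ → Vec d → ℝ) (t : ℕ) : Vec d :=
  let s := state X rule α obs (batchAt X rule α obs t)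
  (rule (batchAt X rule α obs t) s.active).getD (t - s.start) 0

/-- The number of batches used in the first `T` rounds. -/
def numBatches {d : ℕ} (X : Finset (Vec d)) (rule : ℕ → Finset (Vec d) → List (Vec d)) (α : ℝ)
    (obs : ℕ → Vec d → ℝ) (T : ℕ) : ℕ :=
  ((Finset.range T).image (batchAt X rule α obs)).card

/-- The cumulative regret `R_T = ∑ (f^* - f₀(x_t))` over the first `T` rounds. -/
def regret {d : ℕ} (X : Finset (Vec d)) (hX : X.Nonempty) (f₀ : Vec d → ℝ)
    (rule : ℕ → Finset (Vec d) → List (Vec d)) (α : ℝ) (obs : ℕ → Vec d → ℝ) (T : ℕ) : ℝ :=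
  ∑ t ∈ Finset.range T, (fstar X hX f₀ - f₀ (action X rule α obs t))

end PhasedElim

end

/-!
Write `L = log (k T)`, `β_ℓ = √(d L / m_ℓ)` for the confidence width of batch `ℓ`, and
`gap x = f^* - f₀ x`. The regret bound is a deterministic statement about every run in which the
noise is small, combined with a union bound over batches and actions.

*Least squares.* For an active action `x` the estimate of `⟪w, x⟫` is a linear combination of the
rewards of the batch whose coefficients `c` reproduce linear reward functions and satisfy
`‖c‖² ≤ 2 d / m_ℓ` (`IsDesignSequence.exists_coeff`), because the Gram matrix of the batch dominates
`m_ℓ V(π)`. Hence the noise term is sub-Gaussian with variance proxy `2 σ² d / m_ℓ`, and it exceeds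
`2 β_ℓ` with probability at most `2 (k T)^(-1/σ²)`. By Cauchy–Schwarz, the misspecification bias is
at most `ρ √(2 κ d)` times the largest active gap, if the batch has at most `κ m_ℓ` rounds
(`IsDesignSequence.abs_error_sub_noise_le`).

*Elimination.* At an optimal action the model is exact. If all active gaps are at most `48 β_ℓ` and
the noise is small, then the estimates are accurate up to `(29 / 4) β_ℓ`, so the optimal action
survives and the gaps of the survivors are at most `48 β_{ℓ+1}` (`gap_le_of_goodBatch`). The constant
is tight enough to require `κ ≤ 3 / 2` instead of `κ ≤ 2`, which holds from the second batch on; in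
the first one the gaps are at most `1`. The induction starts because `β_0 ≥ 1 / 6` unless the whole
horizon lies in the first batch and `T` is at most of order `d L` (`min_batchParam_le`), where the
trivial bound suffices. A round `t` in batch `ℓ` has `t + 1 ≤ 4 m_ℓ`, so its regret is at most
`96 √(d L / (t + 1))`, and summation gives `192 √(d T L)` (`regret_le_of_goodBatch`).

*Adaptivity.* Active set and first round of a batch are random. The event that they take given
values depends only on the noise before that round (`measurableSet_state_eq`), so it is independent
of the noise in the batch, and the tail bound holds conditionally on these values
(`prob_not_goodBatch_le`).

*Batches.* Batch `ℓ` starts at round `2^(ℓ+1) - 2` or later (`two_pow_le_start`), which bounds the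
number of batches, and with it the number of terms in the union bound.
-/

namespace PhasedElim

open scoped Matrix

/-! ### The Moore–Penrose inverse of a symmetric matrix -/

section Pinv

variable {d : ℕ} {G : Matrix (Fin d) (Fin d) ℝ}

lemma continuousOn_spectrum (f : ℝ → ℝ) (G : Matrix (Fin d) (Fin d) ℝ) :
    ContinuousOn f (spectrum ℝ G) :=
  (Matrix.finite_real_spectrum (A := G)).continuousOn f

lemma pinv_mul_comm (hG : IsSelfAdjoint G) : pinv G * G = G * pinv G := by
  have h1 : pinv G * G = cfc (fun t : ℝ => t⁻¹ * t) G := by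
    rw [cfc_mul _ _ G (continuousOn_spectrum _ G) (continuousOn_spectrum _ G), cfc_id' ℝ G]
    rfl
  have h2 : G * pinv G = cfc (fun t : ℝ => t * t⁻¹) G := by
    rw [cfc_mul _ _ G (continuousOn_spectrum _ G) (continuousOn_spectrum _ G), cfc_id' ℝ G]
    rfl
  rw [h1, h2]
  simp only [mul_comm]

lemma mul_pinv_mul (hG : IsSelfAdjoint G) : G * pinv G * G = G := by
  have h : G * pinv G * G = cfc (fun t : ℝ => t * t⁻¹ * t) G := by
    rw [cfc_mul _ _ G (continuousOn_spectrum _ G) (continuousOn_spectrum _ G),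
      cfc_mul _ _ G (continuousOn_spectrum _ G) (continuousOn_spectrum _ G), cfc_id' ℝ G]
    rfl
  rw [h]
  simp only [mul_inv_mul_cancel]
  exact cfc_id' ℝ G

lemma pinv_transpose (G : Matrix (Fin d) (Fin d) ℝ) : (pinv G)ᵀ = pinv G := by
  have h : IsSelfAdjoint (pinv G) := cfc_predicate _ G
  rw [← Matrix.conjTranspose_eq_transpose_of_trivial]
  exact h

lemma dotProduct_mulVec_comm {M : Matrix (Fin d) (Fin d) ℝ} (hM : Mᵀ = M) (u v : Fin d → ℝ) :
    u ⬝ᵥ (M *ᵥ v) = (M *ᵥ u) ⬝ᵥ v := by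
  rw [Matrix.dotProduct_mulVec, ← Matrix.mulVec_transpose, hM]

/-- A vector orthogonal to the kernel of a symmetric matrix lies in its range, and there the
Moore–Penrose inverse is a right inverse. -/
lemma mulVec_pinv_mulVec (hG : Gᵀ = G) {y : Fin d → ℝ}
    (hy : ∀ u, G *ᵥ u = 0 → y ⬝ᵥ u = 0) : G *ᵥ (pinv G *ᵥ y) = y := by
  have hs : IsSelfAdjoint G := by
    rw [IsSelfAdjoint, Matrix.star_eq_conjTranspose, Matrix.conjTranspose_eq_transpose_of_trivial,
      hG]
  set Q : Matrix (Fin d) (Fin d) ℝ := 1 - G * pinv G with hQ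
  have hQt : Qᵀ = Q := by
    rw [hQ, Matrix.transpose_sub, Matrix.transpose_one, Matrix.transpose_mul, pinv_transpose, hG,
      pinv_mul_comm hs]
  have hGQ : G * Q = 0 := by
    rw [hQ, mul_sub, mul_one, ← pinv_mul_comm hs, ← mul_assoc, mul_pinv_mul hs, sub_self]
  have h0 : (Q *ᵥ y) ⬝ᵥ (Q *ᵥ y) = 0 := by
    rw [← dotProduct_mulVec_comm hQt]
    apply hy
    rw [Matrix.mulVec_mulVec, hGQ, Matrix.zero_mulVec]
  have h1 : Q *ᵥ y = 0 := dotProduct_self_eq_zero.1 h0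
  rw [hQ, Matrix.sub_mulVec, Matrix.one_mulVec, sub_eq_zero] at h1
  rw [Matrix.mulVec_mulVec, ← h1]

end Pinv

/-! ### Gram matrices and least squares -/

section Gram

variable {d : ℕ} {ι : Type*}

lemma outer_transpose (x : Vec d) : (outer x)ᵀ = outer x := by
  ext i j
  simp [outer, Matrix.vecMulVec_apply, mul_comm]

lemma gram_transpose (s : Finset ι) (c : ι → ℝ) (x : ι → Vec d) :
    (∑ i ∈ s, c i • outer (x i))ᵀ = ∑ i ∈ s, c i • outer (x i) := by
  simp [Matrix.transpose_sum, Matrix.transpose_smul, outer_transpose]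

lemma dotProduct_gram_mulVec (s : Finset ι) (c : ι → ℝ) (x : ι → Vec d) (u v : Fin d → ℝ) :
    u ⬝ᵥ ((∑ i ∈ s, c i • outer (x i)) *ᵥ v)
      = ∑ i ∈ s, c i * (((x i).ofLp ⬝ᵥ u) * ((x i).ofLp ⬝ᵥ v)) := by
  rw [Matrix.sum_mulVec, dotProduct_sum]
  refine Finset.sum_congr rfl fun i _ => ?_
  rw [Matrix.smul_mulVec, dotProduct_smul, outer, Matrix.vecMulVec_mulVec]
  simp [dotProduct_comm u, mul_comm]

/-- The kernel of a Gram matrix is orthogonal to the vectors it is made of. -/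
lemma dotProduct_eq_zero_of_gram_mulVec_eq_zero (s : Finset ι) (c : ι → ℝ) (x : ι → Vec d)
    (hc : ∀ i ∈ s, 0 ≤ c i) {u : Fin d → ℝ} (hu : (∑ i ∈ s, c i • outer (x i)) *ᵥ u = 0)
    {i : ι} (hi : i ∈ s) (hci : c i ≠ 0) : (x i).ofLp ⬝ᵥ u = 0 := by
  have h := dotProduct_gram_mulVec s c x u u
  rw [hu, dotProduct_zero] at h
  have h2 := (Finset.sum_eq_zero_iff_of_nonneg
    (fun i hi => mul_nonneg (hc i hi) (mul_self_nonneg _))).1 h.symm i hi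
  simpa [hci] using h2

lemma dotProduct_eq_zero_of_mem_span {S : Set (Vec d)} {u : Fin d → ℝ}
    (h : ∀ z ∈ S, z.ofLp ⬝ᵥ u = 0) {x : Vec d} (hx : x ∈ Submodule.span ℝ S) :
    x.ofLp ⬝ᵥ u = 0 := by
  induction hx using Submodule.span_induction with
  | mem z hz => exact h z hz
  | zero => simp
  | add a b _ _ ha hb => simp [add_dotProduct, ha, hb]
  | smul r a _ ha => simp [smul_dotProduct, ha]

/-- If `G ⪰ m V` and `x` lies in the range of both, then `m ‖x‖²_{G⁻¹} ≤ ‖x‖²_{V⁻¹}`. -/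
lemma pinv_quadForm_le {G V : Matrix (Fin d) (Fin d) ℝ} (hV : Vᵀ = V) {m : ℝ} (hm : 0 ≤ m)
    (hVpos : ∀ u : Fin d → ℝ, 0 ≤ u ⬝ᵥ (V *ᵥ u))
    (hle : ∀ u : Fin d → ℝ, m * (u ⬝ᵥ (V *ᵥ u)) ≤ u ⬝ᵥ (G *ᵥ u))
    {x : Fin d → ℝ} (hxG : G *ᵥ (pinv G *ᵥ x) = x) (hxV : V *ᵥ (pinv V *ᵥ x) = x) :
    m * (x ⬝ᵥ (pinv G *ᵥ x)) ≤ x ⬝ᵥ (pinv V *ᵥ x) := by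
  set a := pinv G *ᵥ x
  set b := pinv V *ᵥ x
  -- Expand `0 ≤ ‖m a - b‖²_V`.
  have h1 := hVpos (m • a - b)
  have h2 := hle a
  have e1 : a ⬝ᵥ (V *ᵥ b) = x ⬝ᵥ a := by rw [hxV, dotProduct_comm]
  have e2 : b ⬝ᵥ (V *ᵥ a) = x ⬝ᵥ a := by rw [dotProduct_mulVec_comm hV, hxV]
  have e3 : b ⬝ᵥ (V *ᵥ b) = x ⬝ᵥ b := by rw [hxV, dotProduct_comm]
  have e4 : a ⬝ᵥ (G *ᵥ a) = x ⬝ᵥ a := by rw [hxG, dotProduct_comm]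
  simp only [Matrix.mulVec_sub, Matrix.mulVec_smul, dotProduct_sub, sub_dotProduct,
    dotProduct_smul, smul_dotProduct, smul_eq_mul, e1, e2, e3] at h1
  rw [e4] at h2
  nlinarith [mul_le_mul_of_nonneg_left h2 hm]

lemma inner_eq_dotProduct (x y : Vec d) : inner ℝ x y = x.ofLp ⬝ᵥ y.ofLp := by
  rw [EuclideanSpace.inner_eq_star_dotProduct, dotProduct_comm]
  simp

/-- The least-squares estimate of `⟪w, x⟫` is linear in the rewards. -/
lemma inner_leastSquares (xs : List (Vec d)) (y : ℕ → ℝ) (x : Vec d) :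
    inner ℝ (leastSquares xs y) x
      = ∑ s : Fin xs.length, ((xs.get s).ofLp
          ⬝ᵥ (pinv (∑ s : Fin xs.length, outer (xs.get s)) *ᵥ x.ofLp)) * y s := by
  rw [inner_eq_dotProduct, leastSquares]
  rw [← dotProduct_mulVec_comm (pinv_transpose _), sum_dotProduct]
  simp [smul_dotProduct, mul_comm]

open Classical in
lemma sum_get_eq_sum_count (xs : List (Vec d)) (A : Finset (Vec d)) (hA : ∀ x ∈ xs, x ∈ A)
    (f : Vec d → ℝ) : ∑ s : Fin xs.length, f (xs.get s) = ∑ x ∈ A, (xs.count x : ℝ) * f x := by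
  have h1 : ∑ s : Fin xs.length, f (xs.get s) = (xs.map f).sum := by
    rw [← List.sum_ofFn]
    congr 1
    apply List.ext_get <;> simp
  rw [h1, Finset.sum_list_map_count]
  simp only [nsmul_eq_mul]
  refine Finset.sum_subset (fun x hx => hA x (by simpa using hx)) fun x _ hx => ?_
  rw [List.count_eq_zero_of_not_mem (by simpa using hx)]
  simp

open Classical in
lemma length_eq_sum_count {xs : List (Vec d)} {A : Finset (Vec d)} (h : ∀ x ∈ xs, x ∈ A) :
    (xs.length : ℝ) = ∑ x ∈ A, (xs.count x : ℝ) := by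
  simpa using sum_get_eq_sum_count xs A h (fun _ => 1)

open Classical in
/-- `xs` plays each action `x` exactly `⌈m π(x)⌉` times, for some approximate G-optimal design
`π` on `A`. -/
def IsDesignSequence (A : Finset (Vec d)) (m : ℕ) (xs : List (Vec d)) : Prop :=
  ∃ π : Vec d → ℝ, IsGoodDesign A π ∧ ∀ x, xs.count x = ⌈(m : ℝ) * π x⌉₊

namespace IsDesignSequence

variable {A : Finset (Vec d)} {m : ℕ} {xs : List (Vec d)}

lemma mem (h : IsDesignSequence A m xs) {x : Vec d} (hx : x ∈ xs) : x ∈ A := by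
  classical
  obtain ⟨π, hπ, hc⟩ := h
  by_contra hA
  have := hc x
  rw [hπ.eq_zero x hA, mul_zero, Nat.ceil_zero] at this
  exact (List.count_pos_iff.2 hx).ne' this

lemma le_length (h : IsDesignSequence A m xs) : m ≤ xs.length := by
  classical
  have hm := fun x (hx : x ∈ xs) => h.mem hx
  obtain ⟨π, hπ, hc⟩ := h
  have : (m : ℝ) ≤ xs.length := by
    rw [length_eq_sum_count hm]
    calc (m : ℝ) = ∑ x ∈ A, (m : ℝ) * π x := by rw [← Finset.mul_sum, hπ.sum_eq_one, mul_one]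
      _ ≤ _ := Finset.sum_le_sum fun x _ => by
        rw [hc x]
        exact Nat.le_ceil _
  exact_mod_cast this

lemma length_le (h : IsDesignSequence A m xs) : (xs.length : ℝ) ≤ m + supportBound d := by
  classical
  have hm := fun x (hx : x ∈ xs) => h.mem hx
  obtain ⟨π, hπ, hc⟩ := h
  rw [length_eq_sum_count hm]
  calc ∑ x ∈ A, (xs.count x : ℝ) ≤ ∑ x ∈ A, ((m : ℝ) * π x + if π x ≠ 0 then 1 else 0) := by
        refine Finset.sum_le_sum fun x _ => ?_
        rw [hc x]
        split_ifs with h0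
        · exact (Nat.ceil_lt_add_one (mul_nonneg m.cast_nonneg (hπ.nonneg x))).le
        · rw [not_not] at h0
          simp [h0]
    _ ≤ _ := by
        rw [Finset.sum_add_distrib, ← Finset.mul_sum, hπ.sum_eq_one, mul_one, Finset.sum_boole]
        gcongr
        exact hπ.card_support

/-- The least-squares estimate of `⟪w, x⟫` for an action `x ∈ A` is a linear combination of the
rewards, with coefficients `c` that reproduce linear reward functions exactly and have squared
norm at most `‖x‖²_{G⁻¹} ≤ 2 d / m`. -/
lemma exists_coeff (h : IsDesignSequence A m xs) (hm : 0 < m) {x : Vec d} (hx : x ∈ A) :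
    ∃ c : Fin xs.length → ℝ,
      (∀ y : ℕ → ℝ, inner ℝ (leastSquares xs y) x = ∑ s, c s * y s) ∧
      (∀ w : Vec d, ∑ s, c s * inner ℝ w (xs.get s) = inner ℝ w x) ∧
      ∑ s, c s ^ 2 ≤ 2 * d / m := by
  classical
  have hmem := fun x (hx : x ∈ xs) => h.mem hx
  obtain ⟨π, hπ, hc⟩ := h
  have hGsum : ∑ s : Fin xs.length, outer (xs.get s)
      = ∑ s : Fin xs.length, (1 : ℝ) • outer (xs.get s) := by simp
  set G := ∑ s : Fin xs.length, outer (xs.get s) with hG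
  set V := infoMatrix A π with hV
  have hGt : Gᵀ = G := by rw [hGsum]; exact gram_transpose _ _ _
  have hVt : Vᵀ = V := gram_transpose _ _ _
  have hGq : ∀ u v : Fin d → ℝ, u ⬝ᵥ (G *ᵥ v)
      = ∑ s : Fin xs.length, ((xs.get s).ofLp ⬝ᵥ u) * ((xs.get s).ofLp ⬝ᵥ v) := fun u v => by
    rw [hGsum, dotProduct_gram_mulVec]
    simp
  have hVq : ∀ u : Fin d → ℝ, u ⬝ᵥ (V *ᵥ u) = ∑ x ∈ A, π x * (x.ofLp ⬝ᵥ u * x.ofLp ⬝ᵥ u) :=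
    fun u => dotProduct_gram_mulVec A π id u u
  have hGker : ∀ u, G *ᵥ u = 0 → x.ofLp ⬝ᵥ u = 0 := by
    intro u hu
    refine dotProduct_eq_zero_of_mem_span (fun z hz => ?_) (hπ.spanning x hx)
    have hzpos : 0 < π z := lt_of_le_of_ne (hπ.nonneg z) (Ne.symm hz)
    have hzxs : z ∈ xs := by
      rw [← List.count_pos_iff]
      have : 0 < ⌈(m : ℝ) * π z⌉₊ := Nat.ceil_pos.2 (by positivity)
      rwa [hc z]
    obtain ⟨s, rfl⟩ := List.get_of_mem hzxs
    rw [hGsum] at hu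
    exact dotProduct_eq_zero_of_gram_mulVec_eq_zero Finset.univ (fun _ => 1) (fun s => xs.get s)
      (fun _ _ => zero_le_one) hu (Finset.mem_univ s) one_ne_zero
  have hVker : ∀ u, V *ᵥ u = 0 → x.ofLp ⬝ᵥ u = 0 := by
    intro u hu
    refine dotProduct_eq_zero_of_mem_span (fun z hz => ?_) (hπ.spanning x hx)
    have hzA : z ∈ A := by
      by_contra hzA
      exact hz (hπ.eq_zero z hzA)
    exact dotProduct_eq_zero_of_gram_mulVec_eq_zero A π id (fun i _ => hπ.nonneg i) hu hzA hz
  have hxG := mulVec_pinv_mulVec hGt hGker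
  have hxV := mulVec_pinv_mulVec hVt hVker
  have hle : (m : ℝ) * (x.ofLp ⬝ᵥ (pinv G *ᵥ x.ofLp)) ≤ x.ofLp ⬝ᵥ (pinv V *ᵥ x.ofLp) := by
    refine pinv_quadForm_le hVt m.cast_nonneg (fun u => ?_) (fun u => ?_) hxG hxV
    · rw [hVq]
      exact Finset.sum_nonneg fun x _ => mul_nonneg (hπ.nonneg x) (mul_self_nonneg _)
    · rw [hVq, hGq, sum_get_eq_sum_count xs A hmem
        (fun z => (z.ofLp ⬝ᵥ u) * (z.ofLp ⬝ᵥ u)), Finset.mul_sum]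
      refine Finset.sum_le_sum fun z _ => ?_
      rw [← mul_assoc, hc z]
      exact mul_le_mul_of_nonneg_right (Nat.le_ceil _) (mul_self_nonneg _)
  set a := pinv G *ᵥ x.ofLp with ha
  refine ⟨fun s => (xs.get s).ofLp ⬝ᵥ a, fun y => ?_, fun w => ?_, ?_⟩
  · rw [inner_leastSquares]
  · have := hGq a w.ofLp
    rw [dotProduct_mulVec_comm hGt, hxG] at this
    rw [inner_eq_dotProduct, dotProduct_comm, this]
    simp only [inner_eq_dotProduct, dotProduct_comm w.ofLp]
  · have := hGq a a
    rw [dotProduct_mulVec_comm hGt, hxG] at this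
    simp only [sq]
    rw [← this, le_div_iff₀ (by positivity), mul_comm]
    exact hle.trans (hπ.g_le x hx)

end IsDesignSequence

end Gram

/-! ### Batch lengths -/

section BatchParam

lemma batchParam_eq (d ℓ : ℕ) : batchParam d ℓ = 2 ^ ℓ * batchParam d 0 := by
  simp [batchParam]

lemma log_log_lower {d : ℕ} (hd : 1 ≤ d) : -8 ≤ 4 * (d : ℝ) * Real.log (Real.log d) := by
  obtain rfl | rfl | h3 : d = 1 ∨ d = 2 ∨ 3 ≤ d := by omega
  · simp
  -- Here `log 2 < 1`, so the double logarithm is negative; use `log x ≥ 1 - 1 / x`.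
  · have h := Real.one_sub_inv_le_log_of_pos (Real.log_pos (one_lt_two))
    have h2 : (Real.log 2)⁻¹ ≤ 2 := by
      rw [inv_le_comm₀ (Real.log_pos one_lt_two) two_pos]
      linarith [Real.log_two_gt_d9]
    push_cast
    linarith
  · have h1 : 1 ≤ Real.log d := by
      rw [Real.le_log_iff_exp_le (by positivity)]
      have : (3 : ℝ) ≤ d := by exact_mod_cast h3
      linarith [Real.exp_one_lt_d9]
    have := Real.log_nonneg h1
    have : 0 ≤ 4 * (d : ℝ) * Real.log (Real.log d) := by positivity
    linarith

lemma batchParam_zero_cast {d : ℕ} (hd : 1 ≤ d) :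
    (batchParam d 0 : ℝ) = (⌈4 * (d : ℝ) * Real.log (Real.log d)⌉ : ℝ) + 16 := by
  have h0 : (-8 : ℤ) ≤ ⌈4 * (d : ℝ) * Real.log (Real.log d)⌉ := by
    have := (log_log_lower hd).trans (Int.le_ceil _)
    exact_mod_cast this
  have h : ((⌈4 * (d : ℝ) * Real.log (Real.log d)⌉ + 16).toNat : ℤ)
      = ⌈4 * (d : ℝ) * Real.log (Real.log d)⌉ + 16 := Int.toNat_of_nonneg (by linarith)
  have h' : (((⌈4 * (d : ℝ) * Real.log (Real.log d)⌉ + 16).toNat : ℤ) : ℝ)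
      = ((⌈4 * (d : ℝ) * Real.log (Real.log d)⌉ + 16 : ℤ) : ℝ) := by rw [h]
  simp only [batchParam, pow_zero, one_mul]
  push_cast at h' ⊢
  exact h'

lemma supportBound_le_batchParam {d : ℕ} (hd : 1 ≤ d) : supportBound d ≤ batchParam d 0 := by
  rw [batchParam_zero_cast hd, supportBound]
  gcongr
  exact Int.le_ceil _

lemma batchParam_zero_le {d : ℕ} (hd : 1 ≤ d) :
    (batchParam d 0 : ℝ) ≤ 4 * (d : ℝ) * Real.log (Real.log d) + 17 := by
  rw [batchParam_zero_cast hd]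
  linarith [Int.ceil_lt_add_one (4 * (d : ℝ) * Real.log (Real.log d))]

lemma two_le_batchParam_zero {d : ℕ} (hd : 1 ≤ d) : 2 ≤ batchParam d 0 := by
  have h1 := log_log_lower hd
  have h2 := supportBound_le_batchParam hd
  rw [supportBound] at h2
  have : (2 : ℝ) ≤ batchParam d 0 := by linarith
  exact_mod_cast this

lemma batchParam_pos {d : ℕ} (hd : 1 ≤ d) (ℓ : ℕ) : 0 < batchParam d ℓ := by
  rw [batchParam_eq]
  have := two_le_batchParam_zero hd
  positivity

/-- Either the horizon or the first batch is at most of order `d log (k T)`: if `T` is at least of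
order `log d`, then `log log d` is at most of order `log T`. -/
lemma min_batchParam_le {d k T : ℕ} (hd : 1 ≤ d) (hk : 2 ≤ k) (hT : 1 ≤ T) :
    (min T (batchParam d 0) : ℕ) ≤ 36 * (d * Real.log ((k : ℝ) * T)) := by
  set n := min T (batchParam d 0) with hn
  have hd' : (1 : ℝ) ≤ d := by exact_mod_cast hd
  have hn1 : 1 ≤ n := le_min hT (by have := two_le_batchParam_zero hd; omega)
  have hn1' : (1 : ℝ) ≤ n := by exact_mod_cast hn1
  have hnT : (n : ℝ) ≤ T := by exact_mod_cast min_le_left _ _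
  have hnm : (n : ℝ) ≤ batchParam d 0 := by exact_mod_cast min_le_right _ _
  have hk' : (2 : ℝ) ≤ k := by exact_mod_cast hk
  have hL : Real.log (2 * n) ≤ Real.log ((k : ℝ) * T) :=
    Real.log_le_log (by positivity) (by gcongr)
  have hL2 : 3 / 5 ≤ Real.log (2 * n) :=
    (by linarith [Real.log_two_gt_d9] : 3 / 5 ≤ Real.log 2).trans
      (Real.log_le_log two_pos (by linarith))
  refine le_trans ?_ (by gcongr : 36 * (d * Real.log (2 * n)) ≤ _)
  rcases lt_or_ge (2 * (n : ℝ)) (Real.log d) with h | h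
  · have h1 := Real.log_le_sub_one_of_pos (by linarith : (0 : ℝ) < d)
    have h2 : (d : ℝ) * (3 / 5) ≤ d * Real.log (2 * n) := by gcongr
    linarith
  · have h3 : Real.log (Real.log d) ≤ Real.log (2 * n) := by
      rcases (Real.log_nonneg hd').eq_or_lt with h0 | h0
      · rw [← h0, Real.log_zero]; linarith
      · exact Real.log_le_log h0 h
    have h4 := batchParam_zero_le hd
    have h5 : (d : ℝ) * Real.log (Real.log d) ≤ d * Real.log (2 * n) := by gcongr
    have h6 : (d : ℝ) * (3 / 5) ≤ d * Real.log (2 * n) := by gcongr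
    -- The constant `17` is at most `32 · (3 / 5)`.
    nlinarith [mul_le_mul hd' hL2 (by norm_num) (by linarith)]

end BatchParam

/-! ### The course of the algorithm -/

section Run

variable {d : ℕ} {X : Finset (Vec d)} {rule : ℕ → Finset (Vec d) → List (Vec d)} {α : ℝ}
  {obs : ℕ → Vec d → ℝ}

/-- The confidence width `√((d / m) log (1 / α))` of batch `ℓ`. -/
noncomputable def width (d : ℕ) (α : ℝ) (ℓ : ℕ) : ℝ :=
  Real.sqrt ((d : ℝ) / batchParam d ℓ * Real.log (1 / α))

lemma width_nonneg (d : ℕ) (α : ℝ) (ℓ : ℕ) : 0 ≤ width d α ℓ := Real.sqrt_nonneg _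

/-- The least-squares estimate computed at the end of batch `ℓ`. -/
noncomputable def estimate (X : Finset (Vec d)) (rule : ℕ → Finset (Vec d) → List (Vec d)) (α : ℝ)
    (obs : ℕ → Vec d → ℝ) (ℓ : ℕ) : Vec d :=
  leastSquares (rule ℓ (state X rule α obs ℓ).active)
    fun j => obs ((state X rule α obs ℓ).start + j)
      ((rule ℓ (state X rule α obs ℓ).active).getD j 0)

lemma mem_active_succ {ℓ : ℕ} {x : Vec d} :
    x ∈ (state X rule α obs (ℓ + 1)).active ↔
      x ∈ (state X rule α obs ℓ).active ∧ ∀ b ∈ (state X rule α obs ℓ).active,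
        inner ℝ (estimate X rule α obs ℓ) (b - x) ≤ 16 * width d α ℓ := by
  classical
  simp only [state, Finset.mem_filter]
  rfl

lemma start_succ (ℓ : ℕ) : (state X rule α obs (ℓ + 1)).start
    = (state X rule α obs ℓ).start + (rule ℓ (state X rule α obs ℓ).active).length := rfl

lemma active_subset (ℓ : ℕ) : (state X rule α obs ℓ).active ⊆ X := by
  induction ℓ with
  | zero => exact subset_rfl
  | succ ℓ ih => exact fun x hx => ih (mem_active_succ.1 hx).1

lemma active_nonempty (hX : X.Nonempty) (ℓ : ℕ) : (state X rule α obs ℓ).active.Nonempty := by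
  induction ℓ with
  | zero => exact hX
  | succ ℓ ih =>
    -- The action that maximizes the estimated reward survives.
    obtain ⟨x, hx, hmax⟩ := Finset.exists_max_image _
      (fun z => inner ℝ (estimate X rule α obs ℓ) z) ih
    refine ⟨x, mem_active_succ.2 ⟨hx, fun b hb => ?_⟩⟩
    have := width_nonneg d α ℓ
    rw [inner_sub_right]
    linarith [hmax b hb]

lemma isDesignSequence_rule (hrule : IsValidRule X rule) (hX : X.Nonempty) (ℓ : ℕ) :
    IsDesignSequence (state X rule α obs ℓ).active (batchParam d ℓ)
      (rule ℓ (state X rule α obs ℓ).active) :=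
  hrule ℓ _ (active_subset ℓ) (active_nonempty hX ℓ)

lemma batch_length_le (hrule : IsValidRule X rule) (hd : 1 ≤ d) (hX : X.Nonempty) (ℓ : ℕ) :
    (rule ℓ (state X rule α obs ℓ).active).length ≤ batchParam d ℓ + batchParam d 0 := by
  have := (isDesignSequence_rule (α := α) (obs := obs) hrule hX ℓ).length_le
  have h := this.trans (add_le_add_right (supportBound_le_batchParam hd) _)
  exact_mod_cast h

lemma two_pow_le_start (hrule : IsValidRule X rule) (hd : 1 ≤ d) (hX : X.Nonempty) (ℓ : ℕ) :
    2 ^ (ℓ + 1) ≤ (state X rule α obs ℓ).start + 2 := by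
  induction ℓ with
  | zero => simp
  | succ ℓ ih =>
    have h1 := (isDesignSequence_rule (α := α) (obs := obs) hrule hX ℓ).le_length
    rw [batchParam_eq] at h1
    have h2 : 2 ^ ℓ * 2 ≤ 2 ^ ℓ * batchParam d 0 :=
      Nat.mul_le_mul_left _ (two_le_batchParam_zero hd)
    rw [start_succ, pow_succ, pow_succ]
    rw [pow_succ] at ih
    omega

lemma start_le (hrule : IsValidRule X rule) (hd : 1 ≤ d) (hX : X.Nonempty) (ℓ : ℕ) :
    (state X rule α obs ℓ).start ≤ 2 * batchParam d ℓ := by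
  suffices h : (state X rule α obs ℓ).start + 2 * batchParam d 0 ≤ 2 * batchParam d ℓ by omega
  induction ℓ with
  | zero => simp [state]
  | succ ℓ ih =>
    have h1 := batch_length_le (α := α) (obs := obs) hrule hd hX ℓ
    have h2 := batchParam_eq d ℓ
    have h3 := batchParam_eq d (ℓ + 1)
    have h4 : 1 * batchParam d 0 ≤ 2 ^ ℓ * batchParam d 0 :=
      Nat.mul_le_mul_right _ Nat.one_le_two_pow
    rw [pow_succ, mul_assoc, mul_left_comm] at h3
    rw [start_succ]
    omega

lemma start_batchAt_le (t : ℕ) :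
    (state X rule α obs (batchAt X rule α obs t)).start ≤ t :=
  Nat.findGreatest_spec (P := fun ℓ => (state X rule α obs ℓ).start ≤ t) (Nat.zero_le t)
    (Nat.zero_le t)

lemma lt_start_batchAt_succ (hrule : IsValidRule X rule) (hd : 1 ≤ d) (hX : X.Nonempty) (t : ℕ) :
    t < (state X rule α obs (batchAt X rule α obs t + 1)).start := by
  by_contra! h
  rcases le_or_gt (batchAt X rule α obs t + 1) t with h1 | h1
  · exact Nat.findGreatest_is_greatest (Nat.lt_succ_self _) h1 h
  · have h2 := two_pow_le_start (α := α) (obs := obs) hrule hd hX (batchAt X rule α obs t + 1)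
    have h3 : batchAt X rule α obs t + 1 < 2 ^ (batchAt X rule α obs t + 1) :=
      Nat.lt_two_pow_self
    rw [pow_succ] at h2
    omega

lemma action_mem_active (hrule : IsValidRule X rule) (hd : 1 ≤ d) (hX : X.Nonempty) (t : ℕ) :
    action X rule α obs t ∈ (state X rule α obs (batchAt X rule α obs t)).active := by
  have h1 := start_batchAt_le (X := X) (rule := rule) (α := α) (obs := obs) t
  have h2 := lt_start_batchAt_succ (α := α) (obs := obs) hrule hd hX t
  rw [start_succ] at h2
  refine (isDesignSequence_rule (α := α) (obs := obs) hrule hX _).mem ?_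
  rw [action]
  rw [List.getD_eq_getElem _ _ (by omega)]
  exact List.getElem_mem _

lemma succ_le_four_mul_batchParam (hrule : IsValidRule X rule) (hd : 1 ≤ d) (hX : X.Nonempty)
    (t : ℕ) :
    t + 1 ≤ 4 * batchParam d (batchAt X rule α obs t) := by
  have h1 := lt_start_batchAt_succ (α := α) (obs := obs) hrule hd hX t
  have h2 := start_le (α := α) (obs := obs) hrule hd hX (batchAt X rule α obs t + 1)
  have h3 : batchParam d (batchAt X rule α obs t + 1)
      = 2 * batchParam d (batchAt X rule α obs t) := by
    rw [batchParam_eq, batchParam_eq d (batchAt X rule α obs t), pow_succ]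
    ring
  omega

lemma batchAt_lt (hrule : IsValidRule X rule) (hd : 1 ≤ d) (hX : X.Nonempty) {t T : ℕ}
    (ht : t < T) :
    batchAt X rule α obs t < ⌊Real.logb 2 (1 + T)⌋₊ := by
  rw [← Nat.succ_le_iff]
  apply Nat.le_floor
  rw [Real.le_logb_iff_rpow_le one_lt_two (by positivity), Real.rpow_natCast]
  have h1 := two_pow_le_start (α := α) (obs := obs) hrule hd hX (batchAt X rule α obs t)
  have h2 := start_batchAt_le (X := X) (rule := rule) (α := α) (obs := obs) t
  have : 2 ^ (batchAt X rule α obs t + 1) ≤ 1 + T := by omega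
  exact_mod_cast this

lemma numBatches_le (hrule : IsValidRule X rule) (hd : 1 ≤ d) (hX : X.Nonempty) (T : ℕ) :
    (numBatches X rule α obs T : ℝ) ≤ Real.logb 2 (1 + T) := by
  have hsub : (Finset.range T).image (batchAt X rule α obs)
      ⊆ Finset.range ⌊Real.logb 2 (1 + T)⌋₊ := by
    intro ℓ hℓ
    obtain ⟨t, ht, rfl⟩ := Finset.mem_image.1 hℓ
    exact Finset.mem_range.2 (batchAt_lt hrule hd hX (Finset.mem_range.1 ht))
  have h1 := Finset.card_le_card hsub
  rw [Finset.card_range] at h1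
  refine le_trans (Nat.cast_le.2 h1) (Nat.floor_le ?_)
  exact Real.logb_nonneg one_lt_two (by linarith [T.cast_nonneg (α := ℝ)])

end Run

/-! ### Regret on the event that the noise is small -/

section Regret

variable {d : ℕ}

/-- The least-squares error at `x` is the noise term plus the misspecification bias. By
Cauchy–Schwarz the bias is at most `‖c‖ √u δ`, with `‖c‖² ≤ 2 d / m` for the coefficients `c` of the
estimate and `u` the number of rounds. -/
lemma IsDesignSequence.abs_error_sub_noise_le {A : Finset (Vec d)} {m : ℕ} {xs : List (Vec d)}
    (h : IsDesignSequence A m xs) (hm : 0 < m) {f₀ : Vec d → ℝ} {w : Vec d} {δ κ : ℝ}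
    (hδ : 0 ≤ δ) (hκ : 0 ≤ κ) (hmis : ∀ z ∈ A, |inner ℝ w z - f₀ z| ≤ δ)
    (hlen : (xs.length : ℝ) ≤ κ * m) (e : ℕ → ℝ) {x : Vec d} (hx : x ∈ A) :
    |inner ℝ (leastSquares xs fun j => f₀ (xs.getD j 0) + e j) x - inner ℝ w x
      - inner ℝ (leastSquares xs e) x| ≤ Real.sqrt (2 * κ * d) * δ := by
  obtain ⟨c, hc, hcw, hc2⟩ := h.exists_coeff hm hx
  have hm' : (0 : ℝ) < m := by exact_mod_cast hm
  have hget : ∀ s : Fin xs.length, xs.getD s 0 = xs.get s := fun s => by simp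
  have e1 : inner ℝ (leastSquares xs fun j => f₀ (xs.getD j 0) + e j) x - inner ℝ w x
      - inner ℝ (leastSquares xs e) x
      = ∑ s, c s * (f₀ (xs.get s) - inner ℝ w (xs.get s)) := by
    rw [hc, hc, ← hcw w, ← Finset.sum_sub_distrib, ← Finset.sum_sub_distrib]
    refine Finset.sum_congr rfl fun s _ => ?_
    rw [hget]
    ring
  rw [e1]
  refine abs_le_of_sq_le_sq ?_ (by positivity)
  have h1 : ∑ s : Fin xs.length, (f₀ (xs.get s) - inner ℝ w (xs.get s)) ^ 2 ≤ κ * m * δ ^ 2 := by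
    calc _ ≤ ∑ _s : Fin xs.length, δ ^ 2 := by
          refine Finset.sum_le_sum fun s _ => ?_
          rw [sq_le_sq, abs_of_nonneg hδ, abs_sub_comm]
          exact hmis _ (h.mem (List.get_mem xs s))
      _ = xs.length * δ ^ 2 := by simp
      _ ≤ _ := by gcongr
  calc (∑ s, c s * (f₀ (xs.get s) - inner ℝ w (xs.get s))) ^ 2
      ≤ (∑ s, c s ^ 2) * ∑ s : Fin xs.length, (f₀ (xs.get s) - inner ℝ w (xs.get s)) ^ 2 :=
        Finset.sum_mul_sq_le_sq_mul_sq _ _ _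
    _ ≤ (2 * d / m) * (κ * m * δ ^ 2) := by
        gcongr
    _ = (Real.sqrt (2 * κ * d) * δ) ^ 2 := by
        rw [mul_pow, Real.sq_sqrt (by positivity)]
        field_simp

variable {X : Finset (Vec d)} {rule : ℕ → Finset (Vec d) → List (Vec d)} {α : ℝ}
  {f₀ : Vec d → ℝ} {w : Vec d} {ρ : ℝ}

/-- The noise in batch `ℓ` moves the estimated reward of each active action by at most twice the
confidence width. -/
def GoodBatch (X : Finset (Vec d)) (rule : ℕ → Finset (Vec d) → List (Vec d)) (α : ℝ)
    (f₀ : Vec d → ℝ) (e : ℕ → ℝ) (ℓ : ℕ) : Prop :=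
  let s := state X rule α (fun t x => f₀ x + e t) ℓ
  ∀ x ∈ s.active,
    |inner ℝ (leastSquares (rule ℓ s.active) fun j => e (s.start + j)) x| ≤ 2 * width d α ℓ

/-- The width shrinks by `√2 ≤ 48 / 33` per batch. Here `33` bounds `(16 / 15) (16 + 2 · 29 / 4)`,
the gap of a survivor in widths of the batch just played, when all estimates are accurate up to
`29 / 4` widths. -/
lemma width_succ (d : ℕ) (α : ℝ) (ℓ : ℕ) : width d α ℓ ≤ 48 / 33 * width d α (ℓ + 1) := by
  have h : (d : ℝ) / batchParam d ℓ * Real.log (1 / α)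
      = 2 * ((d : ℝ) / batchParam d (ℓ + 1) * Real.log (1 / α)) := by
    rw [batchParam_eq d ℓ, batchParam_eq d (ℓ + 1)]
    push_cast
    rw [pow_succ]
    ring
  rw [width, width, h, Real.sqrt_mul zero_le_two]
  refine mul_le_mul_of_nonneg_right ?_ (Real.sqrt_nonneg _)
  rw [Real.sqrt_le_left (by norm_num)]
  norm_num

lemma rho_le {d : ℕ} (hd : 1 ≤ d) (hρd : ρ ≤ 1 / (16 * Real.sqrt d)) :
    Real.sqrt d * ρ ≤ 1 / 16 ∧ ρ ≤ 1 / 16 := by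
  have hs : 1 ≤ Real.sqrt d := by
    rw [Real.one_le_sqrt]
    exact_mod_cast hd
  rw [le_div_iff₀ (by positivity)] at hρd
  refine ⟨by linarith, ?_⟩
  by_contra! h
  nlinarith

/-- Elimination on an event where all estimated rewards are accurate up to `29 / 4` widths: the
optimal action survives, and every survivor has a small gap. -/
lemma step_of_error (hX : X.Nonempty) (hgam : IsGAM X hX (fun x => inner ℝ w x) f₀ ρ)
    (hρ : ρ ≤ 1 / 16) {obs : ℕ → Vec d → ℝ} {ℓ : ℕ} {xo : Vec d} (hopt : f₀ xo = fstar X hX f₀)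
    (hxo : xo ∈ (state X rule α obs ℓ).active)
    (herr : ∀ x ∈ (state X rule α obs ℓ).active,
      |inner ℝ (estimate X rule α obs ℓ) x - inner ℝ w x| ≤ 29 / 4 * width d α ℓ) :
    xo ∈ (state X rule α obs (ℓ + 1)).active ∧
      ∀ x ∈ (state X rule α obs (ℓ + 1)).active,
        fstar X hX f₀ - f₀ x ≤ 48 * width d α (ℓ + 1) := by
  obtain ⟨hρ0, -, hgam⟩ := hgam
  have hsub := active_subset (X := X) (rule := rule) (α := α) (obs := obs) ℓ
  have hgap : ∀ x ∈ X, 0 ≤ fstar X hX f₀ - f₀ x := fun x hx =>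
    sub_nonneg.2 (Finset.le_sup' f₀ hx)
  have hwo : inner ℝ w xo = fstar X hX f₀ := by
    have := hgam xo (hsub hxo)
    rw [hopt, sub_self, mul_zero] at this
    linarith [abs_nonpos_iff.1 this]
  have hβ := width_nonneg d α ℓ
  have hβ' := width_succ d α ℓ
  have eo := abs_le.1 (herr xo hxo)
  -- `⟪w, x⟫ ≤ f^* - (1 - ρ) (f^* - f₀ x)`
  have hw : ∀ x ∈ X, inner ℝ w x + 15 / 16 * (fstar X hX f₀ - f₀ x) ≤ fstar X hX f₀ :=
    fun x hx => by
      have h1 := (abs_le.1 (hgam x hx)).2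
      have h2 := mul_le_mul_of_nonneg_right hρ (hgap x hx)
      linarith
  refine ⟨mem_active_succ.2 ⟨hxo, fun b hb => ?_⟩, fun x hx => ?_⟩
  · have eb := abs_le.1 (herr b hb)
    have h1 := hw b (hsub hb)
    have h2 := hgap b (hsub hb)
    rw [inner_sub_right]
    linarith
  · obtain ⟨hx, hel⟩ := mem_active_succ.1 hx
    have ex := abs_le.1 (herr x hx)
    have h1 := hw x (hsub hx)
    have h3 := hel xo hxo
    rw [inner_sub_right] at h3
    linarith

/-- While the noise is small, the optimal action stays active and the gaps of the active actions
are of the order of the confidence width. The first batch is treated apart, because its length may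
exceed `batchParam d 0` by a factor up to `2`; there the gaps are at most `1`. In later batches the
factor is at most `3 / 2`. -/
lemma gap_le_of_goodBatch (hd : 1 ≤ d) (hX : X.Nonempty) (hrule : IsValidRule X rule)
    (hgam : IsGAM X hX (fun x => inner ℝ w x) f₀ ρ) (hρd : ρ ≤ 1 / (16 * Real.sqrt d))
    (hb : ∀ x ∈ X, fstar X hX f₀ - f₀ x ≤ 1) (hβ0 : 1 ≤ 6 * width d α 0) {e : ℕ → ℝ}
    {xo : Vec d} (hxo : xo ∈ X) (hopt : f₀ xo = fstar X hX f₀) {ℓ : ℕ}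
    (hgood : ∀ j < ℓ, GoodBatch X rule α f₀ e j) :
    xo ∈ (state X rule α (fun t x => f₀ x + e t) ℓ).active ∧
      ∀ x ∈ (state X rule α (fun t x => f₀ x + e t) ℓ).active,
        fstar X hX f₀ - f₀ x ≤ 48 * width d α ℓ := by
  obtain ⟨hρs, hρ1⟩ := rho_le hd hρd
  have hρ0 := hgam.1
  induction ℓ with
  | zero => exact ⟨hxo, fun x hx => by linarith [hb x hx]⟩
  | succ ℓ ih =>
    obtain ⟨ihxo, ihgap⟩ := ih fun j hj => hgood j (hj.trans (Nat.lt_succ_self _))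
    refine step_of_error hX hgam hρ1 hopt ihxo fun x hx => ?_
    set A := (state X rule α (fun t x => f₀ x + e t) ℓ).active
    have hβ := width_nonneg d α ℓ
    have hds := isDesignSequence_rule (α := α) (obs := fun t x => f₀ x + e t) hrule hX ℓ
    have hsub := active_subset (X := X) (rule := rule) (α := α) (obs := fun t x => f₀ x + e t) ℓ
    have hlen : ((rule ℓ A).length : ℝ) ≤ batchParam d ℓ + batchParam d 0 := by
      exact_mod_cast batch_length_le hrule hd hX ℓ
    have hbp : (batchParam d ℓ : ℝ) = 2 ^ ℓ * batchParam d 0 := by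
      rw [batchParam_eq]
      push_cast
      ring
    have hnoise := abs_le.1 (hgood ℓ (Nat.lt_succ_self _) x hx)
    have hmis : ∀ {D : ℝ}, (∀ z ∈ A, fstar X hX f₀ - f₀ z ≤ D) → ∀ z ∈ A,
        |inner ℝ w z - f₀ z| ≤ ρ * D := fun hD z hz =>
      (hgam.2.2 z (hsub hz)).trans (mul_le_mul_of_nonneg_left (hD z hz) hρ0)
    -- A misspecification of `ρ D` with `κ` rounds per unit of `batchParam` costs at most `21 / 4`
    -- widths, the noise at most `2`. Here `r` is an upper bound for `√(2 κ)`.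
    have key : ∀ {κ D r : ℝ}, 0 ≤ κ → 0 ≤ D → 0 ≤ r → 2 * κ ≤ r ^ 2 →
        (∀ z ∈ A, fstar X hX f₀ - f₀ z ≤ D) → ((rule ℓ A).length : ℝ) ≤ κ * batchParam d ℓ →
        r * D ≤ 84 * width d α ℓ →
        |inner ℝ (estimate X rule α (fun t x => f₀ x + e t) ℓ) x - inner ℝ w x|
          ≤ 29 / 4 * width d α ℓ := by
      intro κ D r hκ hD hr hκr hgap hl hrD
      have h1 := abs_le.1 (hds.abs_error_sub_noise_le (batchParam_pos hd ℓ) (mul_nonneg hρ0 hD) hκ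
        (hmis hgap) hl (fun j => e ((state X rule α (fun t x => f₀ x + e t) ℓ).start + j)) hx)
      have h2 : Real.sqrt (2 * κ * d) * (ρ * D) ≤ 21 / 4 * width d α ℓ := by
        have h3 : Real.sqrt (2 * κ) ≤ r := (Real.sqrt_le_left hr).2 hκr
        calc Real.sqrt (2 * κ * d) * (ρ * D)
            = Real.sqrt (2 * κ) * D * (Real.sqrt d * ρ) := by
              rw [Real.sqrt_mul (by positivity)]
              ring
          _ ≤ r * D * (1 / 16) := by gcongr
          _ ≤ _ := by linarith
      have h4 : inner ℝ (estimate X rule α (fun t x => f₀ x + e t) ℓ) x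
          = inner ℝ (leastSquares (rule ℓ A) fun j => f₀ ((rule ℓ A).getD j 0)
            + e ((state X rule α (fun t x => f₀ x + e t) ℓ).start + j)) x := rfl
      rw [h4, abs_le]
      constructor <;> linarith
    rcases Nat.eq_zero_or_pos ℓ with rfl | hℓ
    · refine key (κ := 2) (D := 1) (r := 2) (by norm_num) (by norm_num) (by norm_num)
        (by norm_num) (fun z hz => hb z (hsub hz)) (by linarith) (by linarith)
    · have hp : (2 : ℝ) ≤ 2 ^ ℓ := by
        simpa using pow_le_pow_right₀ (one_le_two (α := ℝ)) hℓ
      have hp' : (2 : ℝ) * batchParam d 0 ≤ batchParam d ℓ := by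
        rw [hbp]
        gcongr
      -- `√3 ≤ 7 / 4`
      refine key (κ := 3 / 2) (D := 48 * width d α ℓ) (r := 7 / 4) (by norm_num) (by positivity)
        (by norm_num) (by norm_num) ihgap (by linarith) (by linarith)

lemma sum_inv_sqrt_le (T : ℕ) :
    ∑ t ∈ Finset.range T, 1 / Real.sqrt ((t : ℝ) + 1) ≤ 2 * Real.sqrt T := by
  induction T with
  | zero => simp
  | succ T ih =>
    rw [Finset.sum_range_succ]
    push_cast
    have h1 : (0 : ℝ) < Real.sqrt ((T : ℝ) + 1) := Real.sqrt_pos.2 (by positivity)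
    have h2 := Real.sqrt_nonneg (T : ℝ)
    have h3 := Real.sq_sqrt (by positivity : (0 : ℝ) ≤ (T : ℝ) + 1)
    have h4 := Real.sq_sqrt (by positivity : (0 : ℝ) ≤ (T : ℝ))
    have h5 : 1 / Real.sqrt ((T : ℝ) + 1) ≤ 2 * (Real.sqrt ((T : ℝ) + 1) - Real.sqrt T) := by
      rw [div_le_iff₀ h1]
      nlinarith [sq_nonneg (Real.sqrt ((T : ℝ) + 1) - Real.sqrt T)]
    linarith

/-- The regret bound on the event that the noise is small in all batches that end before
round `T`. -/
lemma regret_le_of_goodBatch (hd : 1 ≤ d) (hX : X.Nonempty) (hrule : IsValidRule X rule)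
    (hgam : IsGAM X hX (fun x => inner ℝ w x) f₀ ρ) (hρd : ρ ≤ 1 / (16 * Real.sqrt d))
    (hb : ∀ x ∈ X, ∀ x' ∈ X, |f₀ x - f₀ x'| ≤ 1) {T : ℕ} (hT : 1 ≤ T) {e : ℕ → ℝ}
    (hgood : ∀ ℓ < ⌊Real.logb 2 (1 + T)⌋₊, GoodBatch X rule (1 / ((X.card : ℝ) * T)) f₀ e ℓ) :
    regret X hX f₀ rule (1 / ((X.card : ℝ) * T)) (fun t x => f₀ x + e t) T
      ≤ 192 * Real.sqrt (d * T * Real.log ((X.card : ℝ) * T)) := by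
  set α := 1 / ((X.card : ℝ) * T) with hα
  set obs : ℕ → Vec d → ℝ := fun t x => f₀ x + e t with hobs
  set L := Real.log ((X.card : ℝ) * T) with hL
  have hT' : (1 : ℝ) ≤ T := by exact_mod_cast hT
  have hlogα : Real.log (1 / α) = L := by rw [hα, one_div_one_div]
  have hact : ∀ t, action X rule α obs t ∈ X := fun t =>
    active_subset _ (action_mem_active hrule hd hX t)
  obtain ⟨xo, hxo, hopt⟩ := Finset.exists_mem_eq_sup' hX f₀
  have hopt' : f₀ xo = fstar X hX f₀ := hopt.symm
  have hb1 : ∀ x ∈ X, fstar X hX f₀ - f₀ x ≤ 1 := fun x hx => by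
    rw [← hopt']
    exact (abs_le.1 (hb xo hxo x hx)).2
  rcases Nat.lt_or_ge 1 X.card with hk | hk
  swap
  -- With a single action there is no regret.
  · have h0 : regret X hX f₀ rule α obs T = 0 := by
      refine Finset.sum_eq_zero fun t _ => ?_
      rw [Finset.card_le_one.1 hk _ (hact t) _ hxo, hopt', sub_self]
    rw [h0]
    positivity
  have hmin := min_batchParam_le hd hk hT
  rw [← hL] at hmin
  have hdL : 0 ≤ (d : ℝ) * L := by
    have : (0 : ℝ) ≤ (min T (batchParam d 0) : ℕ) := Nat.cast_nonneg _
    linarith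
  have hsplit : Real.sqrt (d * T * L) = Real.sqrt (d * L) * Real.sqrt T := by
    rw [← Real.sqrt_mul hdL]
    congr 1
    ring
  rcases le_or_gt T (batchParam d 0) with hTm | hTm
  -- The horizon is at most `m_0`: each round costs at most `1`, and `T` is of order `d log (k T)`.
  · rw [min_eq_left hTm] at hmin
    have h1 : Real.sqrt T ≤ 6 * Real.sqrt (d * L) := by
      rw [Real.sqrt_le_left (by positivity), mul_pow, Real.sq_sqrt hdL]
      linarith
    calc regret X hX f₀ rule α obs T ≤ ∑ _t ∈ Finset.range T, (1 : ℝ) :=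
          Finset.sum_le_sum fun t _ => hb1 _ (hact t)
      _ = Real.sqrt T * Real.sqrt T := by simp
      _ ≤ 6 * Real.sqrt (d * L) * Real.sqrt T := by gcongr
      _ ≤ 192 * Real.sqrt (d * T * L) := by
        rw [hsplit]
        nlinarith [mul_nonneg (Real.sqrt_nonneg (d * L)) (Real.sqrt_nonneg (T : ℝ))]
  · rw [min_eq_right hTm.le] at hmin
    have hm0 : (0 : ℝ) < batchParam d 0 := by exact_mod_cast batchParam_pos hd 0
    have hβ0 : 1 ≤ 6 * width d α 0 := by
      have h1 : Real.sqrt (1 / 36) ≤ width d α 0 := by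
        refine Real.sqrt_le_sqrt ?_
        rw [hlogα, div_mul_eq_mul_div, le_div_iff₀ hm0]
        linarith
      have h2 : Real.sqrt (1 / 36) = 1 / 6 := by
        rw [show (1 : ℝ) / 36 = (1 / 6) ^ 2 by norm_num, Real.sqrt_sq (by norm_num)]
      linarith
    have hround : ∀ t ∈ Finset.range T, fstar X hX f₀ - f₀ (action X rule α obs t)
        ≤ 96 * Real.sqrt (d * L) * (1 / Real.sqrt ((t : ℝ) + 1)) := by
      intro t ht
      have hlt := batchAt_lt (α := α) (obs := obs) hrule hd hX (Finset.mem_range.1 ht)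
      have h1 := (gap_le_of_goodBatch hd hX hrule hgam hρd hb1 hβ0 hxo hopt'
        (ℓ := batchAt X rule α obs t) fun j hj => hgood j (hj.trans hlt)).2 _
        (action_mem_active hrule hd hX t)
      have h2 : ((t : ℝ) + 1) ≤ 4 * batchParam d (batchAt X rule α obs t) := by
        exact_mod_cast succ_le_four_mul_batchParam hrule hd hX t
      have h3 : width d α (batchAt X rule α obs t)
          ≤ 2 * Real.sqrt (d * L) * (1 / Real.sqrt ((t : ℝ) + 1)) := by
        have hm : (0 : ℝ) < batchParam d (batchAt X rule α obs t) := by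
          exact_mod_cast batchParam_pos hd _
        rw [width, Real.sqrt_le_left (by positivity), hlogα, mul_pow, mul_pow, div_pow,
          Real.sq_sqrt hdL, Real.sq_sqrt (by positivity), div_mul_eq_mul_div, one_pow,
          mul_one_div, div_le_div_iff₀ hm (by positivity)]
        nlinarith
      linarith
    calc regret X hX f₀ rule α obs T
        ≤ ∑ t ∈ Finset.range T, 96 * Real.sqrt (d * L) * (1 / Real.sqrt ((t : ℝ) + 1)) :=
          Finset.sum_le_sum hround
      _ = 96 * Real.sqrt (d * L) * ∑ t ∈ Finset.range T, 1 / Real.sqrt ((t : ℝ) + 1) := by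
          rw [Finset.mul_sum]
      _ ≤ 96 * Real.sqrt (d * L) * (2 * Real.sqrt T) := by
          gcongr
          exact sum_inv_sqrt_le T
      _ = _ := by
          rw [hsplit]
          ring

end Regret

/-! ### Concentration of the noise -/

section Noise

variable {Ω : Type*} {η : ℕ → Ω → ℝ} {σ : ℝ≥0}

/-- The σ-algebra generated by the noise before round `n`. -/
@[reducible] def past (η : ℕ → Ω → ℝ) (n : ℕ) : MeasurableSpace Ω :=
  ⨆ i ∈ Set.Iio n, MeasurableSpace.comap (η i) inferInstance

/-- The σ-algebra generated by the noise from round `n` on. -/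
@[reducible] def future (η : ℕ → Ω → ℝ) (n : ℕ) : MeasurableSpace Ω :=
  ⨆ i ∈ Set.Ici n, MeasurableSpace.comap (η i) inferInstance

lemma measurable_past {i n : ℕ} (h : i < n) : Measurable[past η n] (η i) :=
  measurable_iff_comap_le.2
    (le_iSup₂_of_le (f := fun i (_ : i ∈ Set.Iio n) => MeasurableSpace.comap (η i) inferInstance)
      i h le_rfl)

lemma measurable_future {i n : ℕ} (h : n ≤ i) : Measurable[future η n] (η i) :=
  measurable_iff_comap_le.2
    (le_iSup₂_of_le (f := fun i (_ : i ∈ Set.Ici n) => MeasurableSpace.comap (η i) inferInstance)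
      i h le_rfl)

lemma past_mono {n n' : ℕ} (h : n ≤ n') : past η n ≤ past η n' :=
  iSup₂_le fun _ hi => measurable_iff_comap_le.1 (measurable_past (lt_of_lt_of_le hi h))

variable [mΩ : MeasurableSpace Ω] {P : Measure Ω}

lemma hasSubgaussianMGF_mono {Y : Ω → ℝ} {c c' : ℝ≥0} (h : HasSubgaussianMGF Y c P)
    (hc : c ≤ c') : HasSubgaussianMGF Y c' P where
  integrable_exp_mul := h.integrable_exp_mul
  mgf_le t := (h.mgf_le t).trans (by gcongr)

/-- The bound `v` on the sum of squared weights need not be attained, so that the Chernoff bound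
is meaningful even if all weights vanish. -/
lemma hasSubgaussianMGF_weighted_sum (hindep : iIndepFun η P)
    (hsub : ∀ t, HasSubgaussianMGF (η t) (σ ^ 2) P) (n : ℕ) {N : ℕ} (c : Fin N → ℝ) {v : ℝ≥0}
    (hv : ∑ s, c s ^ 2 ≤ v) :
    HasSubgaussianMGF (fun ω => ∑ s, c s * η (n + s) ω) (v * σ ^ 2) P := by
  have hinj : Function.Injective fun s : Fin N => n + (s : ℕ) := fun a b hab => by
    simpa [Fin.ext_iff] using hab
  have h1 : iIndepFun (fun (s : Fin N) ω => c s * η (n + s) ω) P :=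
    (hindep.precomp hinj).comp (fun s x => c s * x) fun s => measurable_const_mul (c s)
  have h2 := HasSubgaussianMGF.sum_of_iIndepFun (s := Finset.univ) h1
    (c := fun s => Real.toNNReal (c s ^ 2) * σ ^ 2) fun s _ => by
      rw [Real.toNNReal_of_nonneg (sq_nonneg _)]
      exact (hsub (n + s)).const_mul (c s)
  refine hasSubgaussianMGF_mono h2 ?_
  rw [← Finset.sum_mul]
  gcongr
  rw [← NNReal.coe_le_coe]
  push_cast
  simpa [Real.coe_toNNReal _ (sq_nonneg _)] using hv

lemma prob_lt_abs_weighted_sum_le [IsProbabilityMeasure P] (hindep : iIndepFun η P)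
    (hsub : ∀ t, HasSubgaussianMGF (η t) (σ ^ 2) P) (n : ℕ) {N : ℕ} (c : Fin N → ℝ) {v : ℝ≥0}
    (hv : ∑ s, c s ^ 2 ≤ v) {ε : ℝ} (hε : 0 ≤ ε) :
    P.real {ω | ε < |∑ s, c s * η (n + s) ω|} ≤ 2 * Real.exp (-ε ^ 2 / (2 * (v * σ ^ 2))) := by
  have h := hasSubgaussianMGF_weighted_sum hindep hsub n c hv
  have h1 := h.measure_ge_le hε
  have h2 := h.neg.measure_ge_le hε
  push_cast at h1 h2
  calc P.real {ω | ε < |∑ s, c s * η (n + s) ω|}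
      ≤ P.real ({ω | ε ≤ ∑ s, c s * η (n + s) ω}
          ∪ {ω | ε ≤ (-fun ω => ∑ s, c s * η (n + s) ω) ω}) := by
        refine measureReal_mono fun ω hω => ?_
        rcases lt_abs.1 (Set.mem_ofPred.1 hω) with h | h
        · exact Or.inl h.le
        · exact Or.inr h.le
    _ ≤ _ := (measureReal_union_le _ _).trans (by linarith)

lemma past_le (hmeas : ∀ t, Measurable (η t)) (n : ℕ) : past η n ≤ mΩ :=
  iSup₂_le fun i _ => (hmeas i).comap_le

lemma indep_past_future (hmeas : ∀ t, Measurable (η t)) (hindep : iIndepFun η P) (n : ℕ) :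
    Indep (past η n) (future η n) P :=
  indep_iSup_of_disjoint (fun i => (hmeas i).comap_le) ((iIndepFun_iff_iIndep _ _ _).1 hindep)
    (Set.disjoint_left.2 fun _ h1 h2 => (not_lt.2 (Set.mem_Ici.1 h2)) (Set.mem_Iio.1 h1))

end Noise

/-! ### Independence of the state at the start of a batch and the noise in the batch -/

section Adaptive

variable {d : ℕ} {Ω : Type*} {X : Finset (Vec d)} {rule : ℕ → Finset (Vec d) → List (Vec d)}
  {α : ℝ} {f₀ : Vec d → ℝ} {η : ℕ → Ω → ℝ} {σ : ℝ≥0}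

lemma measurable_inner_leastSquares [MeasurableSpace Ω] (xs : List (Vec d)) (x : Vec d)
    {y : ℕ → Ω → ℝ} (hy : ∀ j < xs.length, Measurable (y j)) :
    Measurable fun ω => (inner ℝ (leastSquares xs fun j => y j ω) x : ℝ) := by
  simp only [inner_leastSquares]
  exact Finset.measurable_sum _ fun s _ => (hy s s.2).const_mul _

lemma measurableSet_filter_eq [MeasurableSpace Ω] {V : Type*} (A A' : Finset V) (p : Ω → V → Prop)
    [∀ ω, DecidablePred (p ω)] (hp : ∀ x ∈ A, MeasurableSet {ω | p ω x}) :
    MeasurableSet {ω | A.filter (p ω) = A'} := by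
  by_cases hA : A' ⊆ A
  · have : {ω | A.filter (p ω) = A'} = ⋂ x ∈ A, {ω | p ω x ↔ x ∈ A'} := by
      ext ω
      simp only [Set.mem_ofPred_eq, Set.mem_iInter, Finset.ext_iff, Finset.mem_filter]
      exact ⟨fun h x hx => by simpa [hx] using h x,
        fun h x => ⟨fun hx => (h x hx.1).1 hx.2, fun hx => ⟨hA hx, (h x (hA hx)).2 hx⟩⟩⟩
    rw [this]
    exact Finset.measurableSet_biInter _ fun x hx => (hp x hx).iff (MeasurableSet.const _)
  · have : {ω | A.filter (p ω) = A'} = ∅ := by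
      ext ω
      simp only [Set.mem_ofPred_eq, Set.mem_empty_iff_false, iff_false]
      rintro rfl
      exact hA (Finset.filter_subset _ _)
    rw [this]
    exact MeasurableSet.empty

/-- The event that batch `ℓ` starts in round `n` with active set `A` depends only on the noise
before round `n`. -/
lemma measurableSet_state_eq (ℓ : ℕ) (A : Finset (Vec d)) (n : ℕ) :
    MeasurableSet[past η n] {ω | state X rule α (fun t x => f₀ x + η t ω) ℓ = ⟨A, n⟩} := by
  classical
  induction ℓ generalizing A n with
  | zero =>
    simp only [state]
    exact @MeasurableSet.const _ (past η n) _
  | succ ℓ ih =>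
    set st : Ω → State d := fun ω => state X rule α (fun t x => f₀ x + η t ω) ℓ
    have hset : {ω | state X rule α (fun t x => f₀ x + η t ω) (ℓ + 1) = ⟨A, n⟩}
        = ⋃ B ∈ X.powerset, ⋃ i ∈ Finset.range (n + 1),
          {ω | st ω = ⟨B, i⟩} ∩ ({ω | (B.filter fun x => ∀ b ∈ B,
              inner ℝ (leastSquares (rule ℓ B) fun j => f₀ ((rule ℓ B).getD j 0) + η (i + j) ω)
                (b - x) ≤ 16 * width d α ℓ) = A} ∩ {_ω | i + (rule ℓ B).length = n}) := by
      ext ω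
      simp only [Set.mem_ofPred_eq, Set.mem_iUnion, Set.mem_inter_iff, Finset.mem_powerset,
        Finset.mem_range, exists_prop]
      constructor
      · intro h
        have h1 := congrArg State.active h
        have h2 := congrArg State.start h
        refine ⟨(st ω).active, active_subset ℓ, (st ω).start, ?_, rfl, h1, h2⟩
        have h3 : (st ω).start + (rule ℓ (st ω).active).length = n := h2
        omega
      · rintro ⟨B, -, i, -, hst, rfl, rfl⟩
        have h0 : state X rule α (fun t x => f₀ x + η t ω) ℓ = ⟨B, i⟩ := hst
        simp only [state, h0]
        rfl
    rw [hset]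
    refine Finset.measurableSet_biUnion _ fun B _ => Finset.measurableSet_biUnion _ fun i hi => ?_
    by_cases hn : i + (rule ℓ B).length = n
    · have hin : i ≤ n := by omega
      refine MeasurableSet.inter (past_mono hin _ (ih B i))
        (MeasurableSet.inter ?_ (@MeasurableSet.const _ (past η n) _))
      refine @measurableSet_filter_eq Ω (past η n) _ B A _ _ fun x _ => ?_
      have hset2 : {ω | ∀ b ∈ B, inner ℝ (leastSquares (rule ℓ B)
            fun j => f₀ ((rule ℓ B).getD j 0) + η (i + j) ω) (b - x) ≤ 16 * width d α ℓ}
          = ⋂ b ∈ B, {ω | inner ℝ (leastSquares (rule ℓ B)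
            fun j => f₀ ((rule ℓ B).getD j 0) + η (i + j) ω) (b - x) ≤ 16 * width d α ℓ} := by
        ext ω
        simp
      rw [hset2]
      refine Finset.measurableSet_biInter _ fun b _ => ?_
      have h : Measurable[past η n] fun ω => (inner ℝ (leastSquares (rule ℓ B)
          fun j => f₀ ((rule ℓ B).getD j 0) + η (i + j) ω) (b - x) : ℝ) :=
        @measurable_inner_leastSquares d Ω (past η n) (rule ℓ B) (b - x) _ fun j hj =>
          (measurable_past (by omega)).const_add _
      exact h measurableSet_Iic
    · convert @MeasurableSet.empty _ (past η n)
      simp [hn]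

/-- The event that, with active set `A` and first round `n`, the noise in batch `ℓ` moves some
estimated reward by more than twice the confidence width. -/
def badEvent (rule : ℕ → Finset (Vec d) → List (Vec d)) (α : ℝ) (η : ℕ → Ω → ℝ) (ℓ : ℕ)
    (A : Finset (Vec d)) (n : ℕ) : Set Ω :=
  ⋃ x ∈ A, {ω | 2 * width d α ℓ < |inner ℝ (leastSquares (rule ℓ A) fun j => η (n + j) ω) x|}

lemma measurableSet_badEvent (ℓ : ℕ) (A : Finset (Vec d)) (n : ℕ) :
    MeasurableSet[future η n] (badEvent rule α η ℓ A n) := by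
  refine Finset.measurableSet_biUnion _ fun x _ => ?_
  have h : Measurable[future η n] fun ω =>
      (inner ℝ (leastSquares (rule ℓ A) fun j => η (n + j) ω) x : ℝ) :=
    @measurable_inner_leastSquares d Ω (future η n) (rule ℓ A) x _ fun j _ =>
      measurable_future (Nat.le_add_right n j)
  exact (continuous_abs.measurable.comp h) measurableSet_Ioi

variable [mΩ : MeasurableSpace Ω] {P : Measure Ω} [IsProbabilityMeasure P]

lemma prob_badEvent_le (hd : 1 ≤ d) (hrule : IsValidRule X rule) (hσ : 0 < σ)
    (hindep : iIndepFun η P) (hsub : ∀ t, HasSubgaussianMGF (η t) (σ ^ 2) P) {K : ℝ} (hK : 1 ≤ K)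
    (ℓ : ℕ) {A : Finset (Vec d)} (hAX : A ⊆ X) (hA : A.Nonempty) (n : ℕ) :
    P.real (badEvent rule (1 / K) η ℓ A n) ≤ X.card * (2 * K ^ (-(1 / (σ : ℝ) ^ 2))) := by
  have hds : IsDesignSequence A (batchParam d ℓ) (rule ℓ A) := hrule ℓ A hAX hA
  have hm : (0 : ℝ) < batchParam d ℓ := by exact_mod_cast batchParam_pos hd ℓ
  have hd' : (0 : ℝ) < d := by exact_mod_cast hd
  have hσ' : (0 : ℝ) < σ := hσ
  have hone : ∀ x ∈ A, P.real {ω | 2 * width d (1 / K) ℓ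
      < |inner ℝ (leastSquares (rule ℓ A) fun j => η (n + j) ω) x|}
        ≤ 2 * K ^ (-(1 / (σ : ℝ) ^ 2)) := by
    intro x hx
    obtain ⟨c, hc, -, hc2⟩ := hds.exists_coeff (batchParam_pos hd ℓ) hx
    set v : ℝ≥0 := ⟨2 * d / batchParam d ℓ, by positivity⟩ with hv
    have hvc : (v : ℝ) = 2 * d / batchParam d ℓ := rfl
    have h := prob_lt_abs_weighted_sum_le hindep hsub n c (v := v) hc2
      (ε := 2 * width d (1 / K) ℓ) (mul_nonneg zero_le_two (width_nonneg _ _ _))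
    simp only [hc]
    refine h.trans_eq ?_
    -- With `ε = 2 β` and `v = 2 d / m`, the exponent `ε² / (2 v σ²)` is `log K / σ²`.
    rw [Real.rpow_def_of_pos (by linarith), mul_pow, width, Real.sq_sqrt, hvc, one_div_one_div]
    · congr 2
      field_simp
    · rw [one_div_one_div]
      have := Real.log_nonneg hK
      positivity
  calc P.real (badEvent rule (1 / K) η ℓ A n)
      ≤ ∑ x ∈ A, P.real {ω | 2 * width d (1 / K) ℓ
        < |inner ℝ (leastSquares (rule ℓ A) fun j => η (n + j) ω) x|} :=
        measureReal_biUnion_finset_le _ _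
    _ ≤ ∑ _x ∈ A, 2 * K ^ (-(1 / (σ : ℝ) ^ 2)) := Finset.sum_le_sum hone
    _ = A.card * (2 * K ^ (-(1 / (σ : ℝ) ^ 2))) := by simp
    _ ≤ _ := by
        gcongr

/-- The union bound over the actions holds although active set and first round of the batch are
random: condition on their values, which are independent of the noise in the batch. -/
lemma prob_not_goodBatch_le (hd : 1 ≤ d) (hX : X.Nonempty) (hrule : IsValidRule X rule)
    (hσ : 0 < σ) (hmeas : ∀ t, Measurable (η t)) (hindep : iIndepFun η P)
    (hsub : ∀ t, HasSubgaussianMGF (η t) (σ ^ 2) P) {K : ℝ} (hK : 1 ≤ K) (ℓ : ℕ) :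
    P.real {ω | ¬ GoodBatch X rule (1 / K) f₀ (fun t => η t ω) ℓ}
      ≤ X.card * (2 * K ^ (-(1 / (σ : ℝ) ^ 2))) := by
  classical
  set α := 1 / K with hα
  set δ := (X.card : ℝ) * (2 * K ^ (-(1 / (σ : ℝ) ^ 2))) with hδ
  have hδ0 : 0 ≤ δ := by positivity
  set E : Finset (Vec d) × ℕ → Set Ω := fun p =>
    {ω | state X rule α (fun t x => f₀ x + η t ω) ℓ = ⟨p.1, p.2⟩} with hE
  set S := (X.powerset.filter Finset.Nonempty) ×ˢ Finset.range (2 * batchParam d ℓ + 1) with hS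
  have hcover : {ω | ¬ GoodBatch X rule α f₀ (fun t => η t ω) ℓ}
      ⊆ ⋃ p ∈ S, E p ∩ badEvent rule α η ℓ p.1 p.2 := by
    intro ω hω
    set s := state X rule α (fun t x => f₀ x + η t ω) ℓ with hs
    have hsS : (s.active, s.start) ∈ S := by
      rw [hS, Finset.mem_product, Finset.mem_filter, Finset.mem_powerset, Finset.mem_range]
      exact ⟨⟨active_subset ℓ, active_nonempty hX ℓ⟩,
        Nat.lt_succ_of_le (start_le hrule hd hX ℓ)⟩
    refine Set.mem_biUnion hsS ⟨rfl, ?_⟩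
    simp only [GoodBatch, Set.mem_ofPred_eq, not_forall, not_le] at hω
    obtain ⟨x, hx, hlt⟩ := hω
    exact Set.mem_biUnion hx hlt
  have hEmeas : ∀ p, MeasurableSet (E p) := fun p =>
    past_le hmeas p.2 _ (measurableSet_state_eq ℓ p.1 p.2)
  have hdisj : Set.PairwiseDisjoint (S : Set (Finset (Vec d) × ℕ)) E := by
    intro p _ q _ hpq
    refine Set.disjoint_left.2 fun ω hp hq => hpq ?_
    have h := (Set.mem_ofPred.1 hp).symm.trans (Set.mem_ofPred.1 hq)
    injection h with h1 h2
    exact Prod.ext h1 h2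
  calc P.real {ω | ¬ GoodBatch X rule α f₀ (fun t => η t ω) ℓ}
      ≤ P.real (⋃ p ∈ S, E p ∩ badEvent rule α η ℓ p.1 p.2) :=
        measureReal_mono hcover (measure_ne_top _ _)
    _ ≤ ∑ p ∈ S, P.real (E p ∩ badEvent rule α η ℓ p.1 p.2) := measureReal_biUnion_finset_le _ _
    _ ≤ ∑ p ∈ S, P.real (E p) * δ := by
        refine Finset.sum_le_sum fun p hp => ?_
        rw [hS, Finset.mem_product, Finset.mem_filter, Finset.mem_powerset] at hp
        have hind := (Indep_iff _ _ _).1 (indep_past_future hmeas hindep p.2) (E p)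
          (badEvent rule α η ℓ p.1 p.2) (measurableSet_state_eq ℓ p.1 p.2)
          (measurableSet_badEvent ℓ p.1 p.2)
        rw [measureReal_def, hind, ENNReal.toReal_mul, ← measureReal_def, ← measureReal_def]
        gcongr
        exact prob_badEvent_le hd hrule hσ hindep hsub hK ℓ hp.1.1 hp.1.2 p.2
    _ = P.real (⋃ p ∈ S, E p) * δ := by
        rw [← Finset.sum_mul, measureReal_biUnion_finset hdisj fun p _ => hEmeas p]
    _ ≤ 1 * δ := by
        gcongr
        exact measureReal_le_one
    _ = δ := one_mul δ

end Adaptive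

end PhasedElim

theorem mainTheorem2 :
    ∃ C : ℝ, 0 < C ∧
      ∀ (d : ℕ) (X : Finset (PhasedElim.Vec d)) (hX : X.Nonempty)
        (W : Set (PhasedElim.Vec d)) (f₀ : PhasedElim.Vec d → ℝ) (Cb Cw ρ : ℝ),
        1 ≤ d →
        PhasedElim.Bounded X W f₀ Cb Cw →
        PhasedElim.MaximizersOnHyperplane X f₀ →
        PhasedElim.ClassIsGAM X hX W f₀ ρ →
        ρ ≤ 1 / (16 * Real.sqrt d) →
      ∀ rule : ℕ → Finset (PhasedElim.Vec d) → List (PhasedElim.Vec d),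
        PhasedElim.IsValidRule X rule →
      ∀ (Ω : Type*) [MeasurableSpace Ω] (P : Measure Ω) [IsProbabilityMeasure P]
        (η : ℕ → Ω → ℝ) (σ : ℝ≥0), 0 < σ →
        (∀ t, Measurable (η t)) →
        iIndepFun η P →
        (∀ t, HasSubgaussianMGF (η t) (σ ^ 2) P) →
      ∀ T : ℕ, 1 ≤ T →
        (1 - 2 * Real.logb 2 (1 + T) * (X.card : ℝ)
              * ((X.card : ℝ) * T) ^ (-(1 / (σ : ℝ) ^ 2))
            ≤ P.real {ω | PhasedElim.regret X hX f₀ rule (1 / ((X.card : ℝ) * T))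
                  (fun t x => f₀ x + η t ω) T
                ≤ C * ((1 + ρ) * Real.sqrt (d * T * Real.log ((X.card : ℝ) * T)))}) ∧
        ∀ ω, (PhasedElim.numBatches X rule (1 / ((X.card : ℝ) * T))
            (fun t x => f₀ x + η t ω) T : ℝ) ≤ Real.logb 2 (1 + T) := by
  refine ⟨192, by norm_num, ?_⟩
  intro d X hX W f₀ Cb Cw ρ hd hbdd _ hgam hρd rule hrule Ω _ P _ η σ hσ hmeas hindep hsub T hT
  obtain ⟨w, -, hgam⟩ := hgam
  have hT' : (1 : ℝ) ≤ T := by exact_mod_cast hT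
  have hk : (1 : ℝ) ≤ X.card := by exact_mod_cast hX.card_pos
  refine ⟨?_, fun ω => PhasedElim.numBatches_le hrule hd hX T⟩
  set N := ⌊Real.logb 2 (1 + T)⌋₊
  set δ := ((X.card : ℝ) * T) ^ (-(1 / (σ : ℝ) ^ 2))
  set R := {ω | PhasedElim.regret X hX f₀ rule (1 / ((X.card : ℝ) * T))
    (fun t x => f₀ x + η t ω) T
      ≤ 192 * ((1 + ρ) * Real.sqrt (d * T * Real.log ((X.card : ℝ) * T)))} with hR
  set B : ℕ → Set Ω := fun ℓ =>
    {ω | ¬ PhasedElim.GoodBatch X rule (1 / ((X.card : ℝ) * T)) f₀ (fun t => η t ω) ℓ} with hB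
  have hcover : (Set.univ : Set Ω) ⊆ R ∪ ⋃ ℓ ∈ Finset.range N, B ℓ := by
    intro ω _
    by_cases hω : ω ∈ ⋃ ℓ ∈ Finset.range N, B ℓ
    · exact Or.inr hω
    · refine Or.inl ?_
      simp only [hB, Set.mem_iUnion, Finset.mem_range, Set.mem_ofPred_eq, not_exists, not_not]
        at hω
      refine (PhasedElim.regret_le_of_goodBatch hd hX hrule hgam hρd hbdd.2.2 hT hω).trans ?_
      have h1 := Real.sqrt_nonneg (d * T * Real.log ((X.card : ℝ) * T))
      nlinarith [mul_nonneg hgam.1 h1]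
  have hNlog : (N : ℝ) ≤ Real.logb 2 (1 + T) :=
    Nat.floor_le (Real.logb_nonneg one_lt_two (by linarith))
  have hδ : 0 ≤ δ := by positivity
  have hunion : P.real (⋃ ℓ ∈ Finset.range N, B ℓ)
      ≤ 2 * Real.logb 2 (1 + T) * (X.card : ℝ) * δ := by
    calc P.real (⋃ ℓ ∈ Finset.range N, B ℓ) ≤ ∑ ℓ ∈ Finset.range N, P.real (B ℓ) :=
          measureReal_biUnion_finset_le _ _
      _ ≤ ∑ _ℓ ∈ Finset.range N, (X.card : ℝ) * (2 * δ) :=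
          Finset.sum_le_sum fun ℓ _ => PhasedElim.prob_not_goodBatch_le hd hX hrule hσ hmeas
            hindep hsub (one_le_mul_of_one_le_of_one_le hk hT') ℓ
      _ = N * ((X.card : ℝ) * (2 * δ)) := by simp
      _ ≤ Real.logb 2 (1 + T) * ((X.card : ℝ) * (2 * δ)) := by gcongr
      _ = _ := by ring
  have htotal : 1 ≤ P.real R + P.real (⋃ ℓ ∈ Finset.range N, B ℓ) := by
    calc (1 : ℝ) = P.real Set.univ := by simp
      _ ≤ P.real (R ∪ ⋃ ℓ ∈ Finset.range N, B ℓ) := measureReal_mono hcover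
      _ ≤ _ := measureReal_union_le _ _
  linarith
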